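/- Let $n\in\mathbb{N}$, $[n]=\{0,1,\dots,n\}$, and let $[\overline n]=\{\overline 0,\dots,\overline n\}$ be a disjoint copy of $[n]$. For a set $A\subseteq [n]\times[\overline n]$ of arcs of the complete bipartite graph on $[n]\sqcup[\overline n]$ put $P_A=\operatorname{conv}\{(\mathbf e_i,\mathbf e_{\overline j}) : (i,\overline j)\in A\}\subset\mathbb{R}^{n+1}\times\mathbb{R}^{n+1}$. Thus $\Delta_n\times\Delta_{\overline n}=P_{[n]\times[\overline n]}$, and for nonempty $I\subseteq[n]$, $\overline J\subseteq[\overline n]$ the polytope $\Delta_I\times\Delta_{\overline J}=P_{I\times \overline J}$ is a face of it. A triangulation of $P_A$ means a geometric simplicial complex with union $P_A$ all of whose vertices are among the points $(\mathbf e_i,\mathbf e_{\overline j})$, $(i,\overline j)\in A$. It is flag if every nonempty finite set of vertices that pairwise span a face spans a face. It is the regular triangulation induced by a height function $\mathsf h\colon A\to\mathbb{R}$ if its cells are exactly the projections of the nonempty lower faces of $\operatorname{conv}\{(\mathbf e_i,\mathbf e_{\overline j},\mathsf h(i,\overline j)) : (i,\overline j)\in A\}$, and it is regular if it is induced by some height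 function. Let $\ell(i,\overline j)\in\{0,\dots,n\}$ be the residue of $j-i$ modulo $n+1$. Two arcs $(i,\overline j),(i',\overline{j'})$ cyclically cross if $$\ell(i',\overline j)<\min\{\ell(i,\overline j),\ell(i',\overline{j'})\}\quad\text{or}\quad \ell(i,\overline{j'})<\min\{\ell(i,\overline j),\ell(i',\overline{j'})\}.$$ For nonempty $I\subseteq[n]$, $\overline J\subseteq[\overline n]$, a cyclic $(I,\overline J)$-tree is an inclusion-maximal set of pairwise cyclically non-crossing arcs in $I\times\overline J$. An $([n],[\overline n])$-tree is an inclusion-maximal set of arcs $(i,\overline j)$ with $i\le j$ that contains no two arcs $(i,\overline j),(i',\overline{j'})$ with $i<i'\le j<j'$. A set $T$ of arcs indexes the simplex $P_T$. Theorem. (1) For every nonempty $I\subseteq[n]$ and $\overline J\subseteq[\overline n]$ there is a flag regular triangulation $\mathcal T_{I,\overline J}$ of $\Delta_I\times\Delta_{\overline J}$ such that $T\mapsto P_T$ is a bijection from the cyclic $(I,\overline J)$-trees onto the maximal simplices of $\mathcal T_{I,\overline J}$. In particular, the cyclic $([n],[\overline n])$-trees index the maximal simplices of a flag regular triangulation $\mathcal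 T_n=\mathcal T_{[n],[\overline n]}$ of $\Delta_n\times\Delta_{\overline n}$. The cells of $\mathcal T_{I,\overline J}$ are exactly the nonempty intersections of cells of $\mathcal T_n$ with $\Delta_I\times\Delta_{\overline J}$. (2) A height function $\mathsf h\colon I\times\overline J\to\mathbb{R}$ induces $\mathcal T_{I,\overline J}$ as a regular triangulation if and only if $$\mathsf h(i,\overline j)+\mathsf h(i',\overline{j'})<\mathsf h(i',\overline j)+\mathsf h(i,\overline{j'})$$ for all $i\neq i'$ in $I$ and $\overline j\neq \overline{j'}$ in $\overline J$ such that $(i,\overline j)$ and $(i',\overline{j'})$ do not cyclically cross. In particular, $\mathsf h(i,\overline j)=f(\ell(i,\overline j))$ induces $\mathcal T_{I,\overline J}$ for every $f\colon \mathbb{R}\to\mathbb{R}$ that is strictly increasing and strictly concave on $[0,n]$. (3) The $([n],[\overline n])$-trees index, via the bijection $T\mapsto P_T$, the maximal simplices of a flag regular triangulation of $\operatorname{conv}\{(\mathbf e_i,\mathbf e_{\overline j}) : 0\le i\le j\le n\}$. -/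

import Mathlib

/-- The ambient space `ℝ^{n+1} × ℝ^{n+1}` of the product of two `n`-simplices. -/
abbrev ProdSpace (n : ℕ) : Type := (Fin (n + 1) → ℝ) × (Fin (n + 1) → ℝ)

/-- An arc `(i, j̄)` of the complete bipartite graph with node set `{0, …, n} ⊔ {0̄, …, n̄}`.
A subgraph is given by its finite set of arcs. -/
abbrev Arc (n : ℕ) : Type := Fin (n + 1) × Fin (n + 1)

/-- The vertex `(e_i, e_j̄)` of the product of simplices. -/
def arcPoint {n : ℕ} (a : Arc n) : ProdSpace n := (Pi.single a.1 1, Pi.single a.2 1)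

theorem arcPoint_injective {n : ℕ} : Function.Injective (arcPoint (n := n)) := by
  rintro ⟨i, j⟩ ⟨i', j'⟩ h
  have h1 : (Pi.single i (1 : ℝ) : Fin (n + 1) → ℝ) = Pi.single i' 1 := congrArg Prod.fst h
  have h2 : (Pi.single j (1 : ℝ) : Fin (n + 1) → ℝ) = Pi.single j' 1 := congrArg Prod.snd h
  have h3 := congrFun h1 i
  have h4 := congrFun h2 j
  simp only [Pi.single_apply] at h3 h4
  simp only [Prod.mk.injEq]
  constructor
  · by_contra hne
    simp [hne] at h3
  · by_contra hne
    simp [hne] at h4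

/-- The vertices of the simplex indexed by a set of arcs. -/
def arcSimplex {n : ℕ} (T : Finset (Arc n)) : Finset (ProdSpace n) :=
  T.map ⟨arcPoint, arcPoint_injective⟩

/-- The polytope `conv {(e_i, e_j̄) : (i, j̄) ∈ A}`. For `A = I ×ˢ J` this is the face
`Δ_I × Δ_J̄` of the product `Δ_n × Δ_n`. -/
def arcPolytope {n : ℕ} (A : Finset (Arc n)) : Set (ProdSpace n) :=
  convexHull ℝ (arcPoint '' (A : Set (Arc n)))

/-- The cyclic length `j - i (mod n+1)` of an arc, a number in `{0, …, n}`
(subtraction in `Fin (n + 1)` is modulo `n + 1`). -/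
def cyclicLength {n : ℕ} (a : Arc n) : ℕ := ((a.2 - a.1 : Fin (n + 1)) : ℕ)

/-- Two arcs `(i, j̄)` and `(i', j̄')` cyclically cross. -/
def CyclicallyCross {n : ℕ} (a b : Arc n) : Prop :=
  (cyclicLength (b.1, a.2) < cyclicLength a ∧ cyclicLength (b.1, a.2) < cyclicLength b) ∨
  (cyclicLength (a.1, b.2) < cyclicLength a ∧ cyclicLength (a.1, b.2) < cyclicLength b)

/-- Cyclic `(I, J̄)`-forests: cyclically non-crossing subgraphs of the complete bipartite graph
on `I ⊔ J̄`. -/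
def IsCyclicForest {n : ℕ} (I J : Finset (Fin (n + 1))) (F : Finset (Arc n)) : Prop :=
  F ⊆ I ×ˢ J ∧ ∀ a ∈ F, ∀ b ∈ F, ¬ CyclicallyCross a b

/-- Cyclic `(I, J̄)`-trees: maximal cyclic `(I, J̄)`-forests. -/
def IsCyclicTree {n : ℕ} (I J : Finset (Fin (n + 1))) (T : Finset (Arc n)) : Prop :=
  Maximal (IsCyclicForest I J) T

/-- The increasing arcs `(i, j̄)`, `i ≤ j`. -/
def increasingArcs (n : ℕ) : Finset (Arc n) :=
  Finset.univ.filter fun a => a.1 ≤ a.2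

/-- `([n], [n̄])`-forests: increasing subgraphs without two arcs `(i, j̄)`, `(i', j̄')` such that
`i < i' ≤ j < j'`. -/
def IsIncreasingForest {n : ℕ} (F : Finset (Arc n)) : Prop :=
  F ⊆ increasingArcs n ∧ ∀ a ∈ F, ∀ b ∈ F, ¬ (a.1 < b.1 ∧ b.1 ≤ a.2 ∧ a.2 < b.2)

/-- `([n], [n̄])`-trees: maximal `([n], [n̄])`-forests. -/
def IsIncreasingTree {n : ℕ} (T : Finset (Arc n)) : Prop :=
  Maximal IsIncreasingForest T

/-- The cells of a geometric simplicial complex, as subsets of the ambient space. -/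
def complexCells {n : ℕ} (K : Geometry.SimplicialComplex ℝ (ProdSpace n)) :
    Set (Set (ProdSpace n)) :=
  {C | ∃ s ∈ K.faces, C = convexHull ℝ (s : Set (ProdSpace n))}

/-- A flag complex: every nonempty finite set of vertices that pairwise span a face is a face. -/
def IsFlagComplex {n : ℕ} (K : Geometry.SimplicialComplex ℝ (ProdSpace n)) : Prop :=
  ∀ s : Finset (ProdSpace n), s.Nonempty →
    (∀ x ∈ s, ∀ y ∈ s, ∃ t ∈ K.faces, x ∈ t ∧ y ∈ t) → s ∈ K.faces

/-- The polytope `conv {(e_i, e_j̄, h(i, j̄)) : (i, j̄) ∈ A}`. -/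
def liftedPolytope {n : ℕ} (A : Finset (Arc n)) (h : Arc n → ℝ) : Set (ProdSpace n × ℝ) :=
  convexHull ℝ ((fun a => (arcPoint a, h a)) '' (A : Set (Arc n)))

/-- The regular subdivision of `arcPolytope A` induced by the heights `h`: its cells are the
projections of the nonempty lower faces of the lifted polytope, i.e. of its faces with a
supporting hyperplane that is the graph of an affine function and lies below the polytope. -/
def regularSubdivision {n : ℕ} (A : Finset (Arc n)) (h : Arc n → ℝ) : Set (Set (ProdSpace n)) :=
  {C | C.Nonempty ∧ ∃ (φ : ProdSpace n →ₗ[ℝ] ℝ) (c : ℝ),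
    (∀ z ∈ liftedPolytope A h, φ z.1 + c ≤ z.2) ∧
    C = Prod.fst '' {z | z ∈ liftedPolytope A h ∧ z.2 = φ z.1 + c}}

/-- `K` is the regular triangulation of `arcPolytope A` induced by the heights `h`. -/
def InducedByHeights {n : ℕ} (K : Geometry.SimplicialComplex ℝ (ProdSpace n))
    (A : Finset (Arc n)) (h : Arc n → ℝ) : Prop :=
  complexCells K = regularSubdivision A h

/-- `K` is a flag regular triangulation of `arcPolytope A`. (That simplices intersect in common
faces is part of being a geometric simplicial complex.) -/
structure IsFlagRegularTriangulation {n : ℕ} (K : Geometry.SimplicialComplex ℝ (ProdSpace n))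
    (A : Finset (Arc n)) : Prop where
  vertices_subset : ∀ s ∈ K.faces, (s : Set (ProdSpace n)) ⊆ arcPoint '' (A : Set (Arc n))
  covers : K.space = arcPolytope A
  flag : IsFlagComplex K
  regular : ∃ h : Arc n → ℝ, InducedByHeights K A h

/-- Cyclically non-crossing height functions on `I × J̄`: of the two ways to match `i, i'` with
`j̄, j̄'`, the cyclically non-crossing one has the smaller total height. -/
def IsCyclicallyNoncrossingHeight {n : ℕ} (I J : Finset (Fin (n + 1))) (h : Arc n → ℝ) : Prop :=
  ∀ i ∈ I, ∀ i' ∈ I, ∀ j ∈ J, ∀ j' ∈ J, i ≠ i' → j ≠ j' →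
    ¬ CyclicallyCross (i, j) (i', j') → h (i, j) + h (i', j') < h (i', j) + h (i, j')

/-!
The points of `Δ_n × Δ_n` are the pairs of row sums and column sums of nonnegative matrices `w` of
total mass one, whose entries are indexed by arcs. Everything rests on the behaviour of matrices
whose support is pairwise cyclically noncrossing.

Of the two perfect matchings on four nodes `i, i', j, j'`, exactly one cyclically crosses, namely
the one that does not contain the shortest of the four arcs (`cyclicallyCross_swap_iff`,
`cyclicallyCross_of_shortest`). Hence a noncrossing matrix is determined by its marginals
(`noncrossing_weight_unique`): after subtracting the common part of two such matrices, their supports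
are disjoint, and the shortest arc joining two nodes of positive marginal is missing from one of the
supports; there the arcs at its two ends cross. On the other hand, if `A` is a set of arcs that is
closed under reconnecting crossing pairs, and if the heights prefer noncrossing matchings, then
reconnecting two crossing arcs lowers the total height, so a matrix on `A` of least total height
with given marginals is noncrossing (`exists_noncrossing_weight`). Together, the noncrossing matrix
is the unique optimum for its marginals (`totalHeight_lt_of_noncrossing`). Uniqueness says that
noncrossing sets index simplices which meet along common faces, existence says that these simplices
cover the polytope, and the complex is flag since being noncrossing is a condition on pairs.

For regularity, let `T` be a maximal noncrossing subset of `A`. A limit argument shows that the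
points indexed by `T` span all points indexed by `A` (`exists_marginals_eq_arcPoint`). Let `φ` be the
functional that agrees with the height on `T`. Writing `arcPoint a` as a combination of the points in
`T` and moving the negative coefficients to the other side, optimality of noncrossing matrices gives
`φ (arcPoint a) < h a` for `a ∉ T` (`lt_of_maximal_of_eq`). Tilting `φ` slightly yields supporting
functionals for smaller noncrossing sets. Conversely, a contact set cannot contain a crossing pair,
and a height function that induces the complex prefers each noncrossing matching because that
matching is an edge.

Both `I ×ˢ J` and the set of increasing arcs are closed under reconnecting crossing pairs, and on
increasing arcs the cyclic and the linear notion of crossing agree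
(`cyclicallyCross_iff_of_increasing`).
-/

/-! ### Cyclic crossings -/

theorem cyclicLength_eq {n : ℕ} (i j : Fin (n + 1)) :
    cyclicLength (i, j) = if (i : ℕ) ≤ j then (j : ℕ) - i else n + 1 + j - i := by
  have hi := i.2
  have hj := j.2
  simp only [cyclicLength, Fin.sub_def]
  split_ifs with h
  · rw [show n + 1 - (i : ℕ) + j = (j - i) + (n + 1) by omega, Nat.add_mod_right,
      Nat.mod_eq_of_lt (by omega)]
  · rw [Nat.mod_eq_of_lt (by omega)]
    omega

theorem cyclicLength_le {n : ℕ} (a : Arc n) : cyclicLength a ≤ n :=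
  Nat.lt_succ_iff.mp (a.2 - a.1).2

theorem CyclicallyCross.fst_ne {n : ℕ} {a b : Arc n} (h : CyclicallyCross a b) : a.1 ≠ b.1 := by
  obtain ⟨i, j⟩ := a
  obtain ⟨i', j'⟩ := b
  rintro rfl
  simp [CyclicallyCross] at h

theorem CyclicallyCross.snd_ne {n : ℕ} {a b : Arc n} (h : CyclicallyCross a b) : a.2 ≠ b.2 := by
  obtain ⟨i, j⟩ := a
  obtain ⟨i', j'⟩ := b
  rintro rfl
  simp [CyclicallyCross] at h

/-- Of the two perfect matchings between `{i, i'}` and `{j, j'}`, exactly one crosses: the one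
which does not contain the shortest of the four arcs. -/
theorem cyclicallyCross_swap_iff {n : ℕ} {i i' j j' : Fin (n + 1)} (hi : i ≠ i') (hj : j ≠ j') :
    CyclicallyCross (i', j) (i, j') ↔ ¬ CyclicallyCross (i, j) (i', j') := by
  have h1 := i.2
  have h2 := i'.2
  have h3 := j.2
  have h4 := j'.2
  rw [Ne, Fin.ext_iff] at hi hj
  simp only [CyclicallyCross, cyclicLength_eq]
  split_ifs <;> omega

theorem cyclicallyCross_of_shortest {n : ℕ} {i i' j j' : Fin (n + 1)} (hi : i ≠ i') (hj : j ≠ j')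
    (h1 : cyclicLength (i, j) ≤ cyclicLength (i', j))
    (h2 : cyclicLength (i, j) ≤ cyclicLength (i, j')) : CyclicallyCross (i, j') (i', j) := by
  have b1 := i.2
  have b2 := i'.2
  have b3 := j.2
  have b4 := j'.2
  rw [Ne, Fin.ext_iff] at hi hj
  right
  simp only [cyclicLength_eq] at *
  split_ifs at * <;> omega

/-- A set of arcs no two of which cyclically cross. -/
def Noncrossing {n : ℕ} (F : Set (Arc n)) : Prop :=
  ∀ a ∈ F, ∀ b ∈ F, ¬ CyclicallyCross a b

theorem Noncrossing.mono {n : ℕ} {F G : Set (Arc n)} (hG : Noncrossing G) (h : F ⊆ G) :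
    Noncrossing F :=
  fun a ha b hb => hG a (h ha) b (h hb)

theorem noncrossing_pair {n : ℕ} {a b : Arc n} (h : ¬ CyclicallyCross a b) :
    Noncrossing ({a, b} : Set (Arc n)) := by
  have h' : ¬ CyclicallyCross b a := by
    simp only [CyclicallyCross] at h ⊢
    tauto
  rintro x (rfl | rfl) y (rfl | rfl)
  · exact fun hc => hc.fst_ne rfl
  · exact h
  · exact h'
  · exact fun hc => hc.fst_ne rfl

/-- A set of arcs which contains, with any two crossing arcs, the two arcs that reconnect their
end points. -/
def UncrossingClosed {n : ℕ} (A : Finset (Arc n)) : Prop :=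
  ∀ a ∈ A, ∀ b ∈ A, CyclicallyCross a b → (b.1, a.2) ∈ A ∧ (a.1, b.2) ∈ A

/-- Heights on `A` for which uncrossing two arcs of `A` lowers the total height. -/
def IsNoncrossingHeightOn {n : ℕ} (A : Finset (Arc n)) (h : Arc n → ℝ) : Prop :=
  ∀ a ∈ A, ∀ b ∈ A, CyclicallyCross a b → h (b.1, a.2) + h (a.1, b.2) < h a + h b

theorem uncrossingClosed_product {n : ℕ} (I J : Finset (Fin (n + 1))) :
    UncrossingClosed (I ×ˢ J) := by
  intro a ha b hb _
  simp only [Finset.mem_product] at *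
  tauto

theorem isNoncrossingHeightOn_product_iff {n : ℕ} {I J : Finset (Fin (n + 1))} {h : Arc n → ℝ} :
    IsNoncrossingHeightOn (I ×ˢ J) h ↔ IsCyclicallyNoncrossingHeight I J h := by
  constructor
  · intro H i hi i' hi' j hj j' hj' hii hjj hnc
    have := H (i', j) (by simp [*]) (i, j') (by simp [*])
      ((cyclicallyCross_swap_iff hii hjj).2 hnc)
    simpa using this
  · rintro H ⟨i, j⟩ ha ⟨i', j'⟩ hb hc
    simp only [Finset.mem_product] at ha hb
    have := H i' hb.1 i ha.1 j ha.2 j' hb.2 hc.fst_ne.symm hc.snd_ne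
      fun h' => (cyclicallyCross_swap_iff hc.fst_ne hc.snd_ne).1 h' hc
    simpa using this

/-- The inequality behind the heights `f ∘ cyclicLength`: if `p` is the smallest of four numbers
with `p + q = r + s` then `p, q` are spread further than `r, s` and concavity applies; if instead
`p + q` is smaller than `r + s` by `n + 1`, then monotonicity suffices. -/
theorem add_lt_add_of_strictMonoOn_of_strictConcaveOn {n p q r s : ℕ} {f : ℝ → ℝ}
    (hf : StrictMonoOn f (Set.Icc 0 (n : ℝ))) (hc : StrictConcaveOn ℝ (Set.Icc 0 (n : ℝ)) f)
    (hq : q ≤ n) (hr : r ≤ n) (hs : s ≤ n) (hpr : p < r) (hps : p < s)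
    (h : p + q = r + s ∨ p + q + (n + 1) = r + s) : f p + f q < f r + f s := by
  have mem : ∀ {k : ℕ}, k ≤ n → (k : ℝ) ∈ Set.Icc 0 (n : ℝ) := fun hk =>
    ⟨Nat.cast_nonneg _, Nat.cast_le.2 hk⟩
  rcases h with h | h
  · have hrq : r < q := by omega
    have h' : (p : ℝ) + q = r + s := by exact_mod_cast h
    have hpr' : (p : ℝ) < r := by exact_mod_cast hpr
    have hrq' : (r : ℝ) < q := by exact_mod_cast hrq
    have hpq : (0 : ℝ) < q - p := by linarith
    have ht : 0 < ((r : ℝ) - p) / (q - p) := div_pos (by linarith) hpq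
    have hu : 0 < ((q : ℝ) - r) / (q - p) := div_pos (by linarith) hpq
    have htu : ((r : ℝ) - p) / (q - p) + ((q : ℝ) - r) / (q - p) = 1 := by
      field_simp
      ring
    have hp := mem (show p ≤ n by omega)
    have e1 := hc.2 hp (mem hq) (by linarith) hu ht (by rw [add_comm, htu])
    have e2 := hc.2 hp (mem hq) (by linarith) ht hu htu
    simp only [smul_eq_mul] at e1 e2
    rw [show ((q : ℝ) - r) / (q - p) * p + (r - p) / (q - p) * q = r by field_simp; ring] at e1
    rw [show ((r : ℝ) - p) / (q - p) * p + (q - r) / (q - p) * q = s by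
      field_simp; rw [show (s : ℝ) = p + q - r by linarith]; ring] at e2
    have e3 : f p + f q = (((r : ℝ) - p) / (q - p) + ((q : ℝ) - r) / (q - p)) * (f p + f q) := by
      rw [htu, one_mul]
    linarith
  · have h1 := hf (mem (by omega)) (mem hr) (Nat.cast_lt.2 hpr)
    have h2 := hf (mem hq) (mem hs) (Nat.cast_lt.2 (show q < s by omega))
    linarith

theorem isNoncrossingHeightOn_comp_cyclicLength {n : ℕ} {f : ℝ → ℝ}
    (hf : StrictMonoOn f (Set.Icc 0 (n : ℝ))) (hc : StrictConcaveOn ℝ (Set.Icc 0 (n : ℝ)) f)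
    (A : Finset (Arc n)) : IsNoncrossingHeightOn A fun a => f (cyclicLength a) := by
  rintro ⟨i, j⟩ - ⟨i', j'⟩ - hx
  have b1 := i.2
  have b2 := i'.2
  have b3 := j.2
  have b4 := j'.2
  -- The shortest arc lies in the reconnected matching, and both matchings have the same total
  -- cyclic length modulo `n + 1`.
  rcases hx with ⟨h1, h2⟩ | ⟨h1, h2⟩
  · refine add_lt_add_of_strictMonoOn_of_strictConcaveOn hf hc (cyclicLength_le _)
      (cyclicLength_le _) (cyclicLength_le _) h1 h2 ?_
    simp only [cyclicLength_eq] at *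
    split_ifs at * <;> omega
  · rw [add_comm]
    refine add_lt_add_of_strictMonoOn_of_strictConcaveOn hf hc (cyclicLength_le _)
      (cyclicLength_le _) (cyclicLength_le _) h1 h2 ?_
    simp only [cyclicLength_eq] at *
    split_ifs at * <;> omega

theorem exists_isNoncrossingHeightOn {n : ℕ} (A : Finset (Arc n)) :
    ∃ h, IsNoncrossingHeightOn A h :=
  ⟨_, isNoncrossingHeightOn_comp_cyclicLength
    (fun _ hx _ _ hxy => Real.sqrt_lt_sqrt hx.1 hxy)
    (Real.strictConcaveOn_sqrt.subset Set.Icc_subset_Ici_self (convex_Icc _ _)) A⟩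

/-! ### Weights on arcs and their marginals -/

/-- The point `∑ w a • arcPoint a`: its coordinates are the row sums and the column sums of the
matrix `w`. -/
noncomputable def marginals {n : ℕ} : (Arc n → ℝ) →ₗ[ℝ] ProdSpace n :=
  Fintype.linearCombination ℝ arcPoint

theorem marginals_apply {n : ℕ} (w : Arc n → ℝ) : marginals w = ∑ a, w a • arcPoint a := rfl

theorem marginals_fst {n : ℕ} (w : Arc n → ℝ) (i : Fin (n + 1)) :
    (marginals w).1 i = ∑ j, w (i, j) := by
  simp [marginals_apply, Prod.fst_sum, Finset.sum_apply, arcPoint, Fintype.sum_prod_type,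
    Pi.single_apply]

theorem marginals_snd {n : ℕ} (w : Arc n → ℝ) (j : Fin (n + 1)) :
    (marginals w).2 j = ∑ i, w (i, j) := by
  simp [marginals_apply, Prod.snd_sum, Finset.sum_apply, arcPoint, Fintype.sum_prod_type,
    Pi.single_apply]

theorem marginals_single {n : ℕ} (a : Arc n) (t : ℝ) :
    marginals (Pi.single a t) = t • arcPoint a := by
  simp [marginals, Fintype.linearCombination_apply_single]

theorem arcPoint_reconnect {n : ℕ} (a b : Arc n) :
    arcPoint (b.1, a.2) + arcPoint (a.1, b.2) = arcPoint a + arcPoint b :=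
  Prod.ext (add_comm _ _) rfl

theorem sum_eq_of_marginals_eq {n : ℕ} {w w' : Arc n → ℝ} (h : marginals w = marginals w') :
    ∑ a, w a = ∑ a, w' a := by
  simp only [Fintype.sum_prod_type, ← marginals_fst, h]

/-- The end points of an arc of positive weight also lie on arcs of positive weight in every other
weight with the same marginals. -/
theorem exists_pos_of_marginals_eq {n : ℕ} {w w' : Arc n → ℝ} (hw : 0 ≤ w)
    (h : marginals w = marginals w') {i j : Fin (n + 1)} (hij : 0 < w (i, j)) :
    (∃ j', 0 < w' (i, j')) ∧ ∃ i', 0 < w' (i', j) := by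
  constructor
  · by_contra! hc
    have h1 : (marginals w').1 i ≤ 0 := by
      rw [marginals_fst]
      exact Finset.sum_nonpos fun j' _ => hc j'
    rw [← h, marginals_fst] at h1
    exact absurd (Finset.single_le_sum (f := fun j => w (i, j)) (fun j _ => hw (i, j))
      (Finset.mem_univ j)) (by linarith)
  · by_contra! hc
    have h1 : (marginals w').2 j ≤ 0 := by
      rw [marginals_snd]
      exact Finset.sum_nonpos fun i' _ => hc i'
    rw [← h, marginals_snd] at h1
    exact absurd (Finset.single_le_sum (f := fun i => w (i, j)) (fun i _ => hw (i, j))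
      (Finset.mem_univ i)) (by linarith)

/-- Two noncrossing weights with disjoint supports and the same marginals vanish. -/
theorem noncrossing_disjoint_eq_zero {n : ℕ} {w w' : Arc n → ℝ} (hw : 0 ≤ w) (hw' : 0 ≤ w')
    (hN : Noncrossing (Function.support w)) (hN' : Noncrossing (Function.support w'))
    (h : marginals w = marginals w') (hd : ∀ a, w a = 0 ∨ w' a = 0) : w = 0 := by
  by_contra hne
  -- Consider the shortest arc `(i, j)` between nodes with positive marginals. It has weight zero in
  -- `w` or in `w'`, and in that weight `i` and `j` lie on two other arcs, which therefore cross.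
  obtain ⟨⟨i₀, j₀⟩, h₀⟩ := Function.ne_iff.1 hne
  have hpos : 0 < w (i₀, j₀) := lt_of_le_of_ne (hw _) (Ne.symm h₀)
  let S : Finset (Arc n) :=
    Finset.univ.filter fun a => (∃ j, 0 < w (a.1, j)) ∧ ∃ i, 0 < w (i, a.2)
  obtain ⟨⟨i, j⟩, hS, hmin⟩ := S.exists_min_image cyclicLength
    ⟨(i₀, j₀), Finset.mem_filter.2 ⟨Finset.mem_univ _, ⟨j₀, hpos⟩, ⟨i₀, hpos⟩⟩⟩
  obtain ⟨-, ⟨j₁, hj₁⟩, ⟨i₁, hi₁⟩⟩ := Finset.mem_filter.1 hS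
  have key : ∀ v : Arc n → ℝ, Noncrossing (Function.support v) → v (i, j) = 0 →
      (∀ {i j}, 0 < v (i, j) → (∃ j', 0 < w (i, j')) ∧ ∃ i', 0 < w (i', j)) →
      ∀ i' j', 0 < v (i, j') → 0 < v (i', j) → False := by
    intro v hv h0 hact i' j' hj' hi'
    have hii : i ≠ i' := by
      rintro rfl
      exact hi'.ne' h0
    have hjj : j ≠ j' := by
      rintro rfl
      exact hj'.ne' h0
    refine hv _ hj'.ne' _ hi'.ne' (cyclicallyCross_of_shortest hii hjj ?_ ?_)
    · exact hmin _ (Finset.mem_filter.2 ⟨Finset.mem_univ _, (hact hi').1, ⟨i₁, hi₁⟩⟩)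
    · exact hmin _ (Finset.mem_filter.2 ⟨Finset.mem_univ _, ⟨j₁, hj₁⟩, (hact hj').2⟩)
  rcases hd (i, j) with h0 | h0
  · exact key w hN h0 (fun hp => ⟨⟨_, hp⟩, ⟨_, hp⟩⟩) i₁ j₁ hj₁ hi₁
  · obtain ⟨j', hj'⟩ := (exists_pos_of_marginals_eq hw h hj₁).1
    obtain ⟨i', hi'⟩ := (exists_pos_of_marginals_eq hw h hi₁).2
    exact key w' hN' h0 (fun hp => exists_pos_of_marginals_eq hw' h.symm hp) i' j' hj' hi'

/-- A noncrossing nonnegative weight is determined by its marginals. -/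
theorem noncrossing_weight_unique {n : ℕ} {w w' : Arc n → ℝ} (hw : 0 ≤ w) (hw' : 0 ≤ w')
    (hN : Noncrossing (Function.support w)) (hN' : Noncrossing (Function.support w'))
    (h : marginals w = marginals w') : w = w' := by
  -- Subtracting the common part `w ⊓ w'` leaves weights with disjoint supports.
  have supp : ∀ {u v : Arc n → ℝ}, 0 ≤ u → 0 ≤ v →
      Function.support (u - u ⊓ v) ⊆ Function.support u := by
    intro u v _ hv a ha h0
    apply ha
    have : 0 ≤ v a := hv a
    have hu0 : u a = 0 := h0
    simp [hu0, this]
  have h1 : w - w ⊓ w' = 0 := by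
    refine noncrossing_disjoint_eq_zero (w' := w' - w ⊓ w') (sub_nonneg.2 inf_le_left)
      (sub_nonneg.2 inf_le_right) (hN.mono (supp hw hw')) ?_ (by simp [map_sub, h]) ?_
    · rw [inf_comm]
      exact hN'.mono (supp hw' hw)
    · intro a
      rcases le_total (w a) (w' a) with hle | hle
      · left
        simp [hle]
      · right
        simp [hle]
  have hle : w ≤ w' := inf_eq_left.1 (sub_eq_zero.1 h1).symm
  ext ⟨i, j⟩
  have hs : ∑ j, w (i, j) = ∑ j, w' (i, j) := by rw [← marginals_fst, h, marginals_fst]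
  exact (Finset.sum_eq_sum_iff_of_le fun j _ => hle (i, j)).1 hs j (Finset.mem_univ j)

/-- The total height `∑ w a * h a` of a weight. -/
noncomputable def totalHeight {n : ℕ} (h : Arc n → ℝ) : (Arc n → ℝ) →ₗ[ℝ] ℝ :=
  Fintype.linearCombination ℝ h

theorem totalHeight_apply {n : ℕ} (h w : Arc n → ℝ) : totalHeight h w = ∑ a, w a * h a := rfl

theorem totalHeight_single {n : ℕ} (h : Arc n → ℝ) (a : Arc n) (t : ℝ) :
    totalHeight h (Pi.single a t) = t * h a := by
  simp [totalHeight, Fintype.linearCombination_apply_single]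

/-- Uncrossing two arcs in the support of a weight lowers the total height. -/
theorem exists_totalHeight_lt_of_crossing {n : ℕ} {A : Finset (Arc n)} (hA : UncrossingClosed A)
    {h : Arc n → ℝ} (hh : IsNoncrossingHeightOn A h) {w : Arc n → ℝ} (hw : 0 ≤ w)
    (hwA : ∀ a ∉ A, w a = 0) (hN : ¬ Noncrossing (Function.support w)) :
    ∃ w', 0 ≤ w' ∧ (∀ a ∉ A, w' a = 0) ∧ marginals w' = marginals w ∧
      totalHeight h w' < totalHeight h w := by
  simp only [Noncrossing, not_forall, not_not] at hN
  obtain ⟨a, ha, b, hb, hc⟩ := hN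
  have haA : a ∈ A := by_contra fun h => ha (hwA a h)
  have hbA : b ∈ A := by_contra fun h => hb (hwA b h)
  obtain ⟨hcA, hdA⟩ := hA a haA b hbA hc
  have hab : a ≠ b := fun h => hc.fst_ne (congrArg _ h)
  have ha0 : 0 < w a := lt_of_le_of_ne (hw a) (Ne.symm ha)
  have hb0 : 0 < w b := lt_of_le_of_ne (hw b) (Ne.symm hb)
  obtain ⟨ε, hε, hεa, hεb⟩ : ∃ ε, 0 < ε ∧ ε ≤ w a ∧ ε ≤ w b :=
    ⟨min (w a) (w b), lt_min ha0 hb0, min_le_left _ _, min_le_right _ _⟩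
  refine ⟨w + (Pi.single (b.1, a.2) ε + Pi.single (a.1, b.2) ε) -
    (Pi.single a ε + Pi.single b ε), ?_, ?_, ?_, ?_⟩
  · have h1 : (Pi.single a ε + Pi.single b ε : Arc n → ℝ) ≤ w := by
      intro x
      have hx := hw x
      simp only [Pi.add_apply, Pi.single_apply, Pi.zero_apply] at *
      split_ifs with h1 h2 h2
      · exact absurd (h1.symm.trans h2) hab
      · simpa [h1] using hεa
      · simpa [h2] using hεb
      · simpa using hx
    have h2 : (0 : Arc n → ℝ) ≤ Pi.single (b.1, a.2) ε + Pi.single (a.1, b.2) ε :=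
      add_nonneg (Pi.single_nonneg.2 hε.le) (Pi.single_nonneg.2 hε.le)
    intro x
    have := h1 x
    have := h2 x
    simp only [Pi.add_apply, Pi.sub_apply, Pi.zero_apply] at *
    linarith
  · intro x hx
    have e1 : x ≠ a := fun h => hx (h ▸ haA)
    have e2 : x ≠ b := fun h => hx (h ▸ hbA)
    have e3 : x ≠ (b.1, a.2) := fun h => hx (h ▸ hcA)
    have e4 : x ≠ (a.1, b.2) := fun h => hx (h ▸ hdA)
    simp [e1, e2, e3, e4, hwA x hx]
  · simp only [map_sub, map_add, marginals_single, ← smul_add]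
    rw [arcPoint_reconnect, add_sub_cancel_right]
  · simp only [map_sub, map_add, totalHeight_single]
    nlinarith [hh a haA b hbA hc]

/-- Every weight on `A` can be uncrossed: a weight of least total height among those with the same
marginals is noncrossing. -/
theorem exists_noncrossing_weight {n : ℕ} {A : Finset (Arc n)} (hA : UncrossingClosed A)
    {h : Arc n → ℝ} (hh : IsNoncrossingHeightOn A h) {w : Arc n → ℝ} (hw : 0 ≤ w)
    (hwA : ∀ a ∉ A, w a = 0) :
    ∃ w', 0 ≤ w' ∧ (∀ a ∉ A, w' a = 0) ∧ marginals w' = marginals w ∧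
      Noncrossing (Function.support w') ∧ totalHeight h w' ≤ totalHeight h w := by
  let S : Set (Arc n → ℝ) :=
    {v | 0 ≤ v} ∩ ({v | ∀ a ∉ A, v a = 0} ∩ {v | marginals v = marginals w})
  have hcl : IsClosed S := by
    refine isClosed_Ici.inter (IsClosed.inter ?_ ?_)
    · simp only [Set.ofPred_forall]
      exact isClosed_iInter fun a => isClosed_iInter fun _ =>
        isClosed_eq (continuous_apply a) continuous_const
    · exact isClosed_eq marginals.continuous_of_finiteDimensional continuous_const
  have hS : IsCompact S := by
    refine isCompact_Icc.of_isClosed_subset (s := Set.Icc 0 fun _ => ∑ a, w a) hcl ?_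
    rintro v ⟨hv, -, hm⟩
    refine ⟨hv, fun a => ?_⟩
    rw [← sum_eq_of_marginals_eq hm]
    exact Finset.single_le_sum (fun b _ => hv b) (Finset.mem_univ a)
  obtain ⟨v, ⟨hv, hvA, hm⟩, hmin⟩ := hS.exists_isMinOn ⟨w, hw, hwA, rfl⟩
    (totalHeight h).continuous_of_finiteDimensional.continuousOn
  refine ⟨v, hv, hvA, hm, ?_, hmin ⟨hw, hwA, rfl⟩⟩
  by_contra hN
  obtain ⟨u, hu, huA, hum, hlt⟩ := exists_totalHeight_lt_of_crossing hA hh hv hvA hN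
  exact not_lt.2 (hmin ⟨hu, huA, hum.trans hm⟩) hlt

/-- A noncrossing weight is the unique weight of least total height with its marginals. -/
theorem totalHeight_lt_of_noncrossing {n : ℕ} {A : Finset (Arc n)} (hA : UncrossingClosed A)
    {h : Arc n → ℝ} (hh : IsNoncrossingHeightOn A h) {w v : Arc n → ℝ} (hw : 0 ≤ w)
    (hN : Noncrossing (Function.support w)) (hv : 0 ≤ v) (hvA : ∀ a ∉ A, v a = 0)
    (hm : marginals w = marginals v) (hne : w ≠ v) : totalHeight h w < totalHeight h v := by
  have hvN : ¬ Noncrossing (Function.support v) := fun hvN =>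
    hne (noncrossing_weight_unique hw hv hN hvN hm)
  obtain ⟨v₁, hv₁, hvA₁, hm₁, hlt⟩ := exists_totalHeight_lt_of_crossing hA hh hv hvA hvN
  obtain ⟨v₂, hv₂, -, hm₂, hN₂, hle⟩ := exists_noncrossing_weight hA hh hv₁ hvA₁
  rw [noncrossing_weight_unique hw hv₂ hN hN₂ (hm.trans (hm₁.symm.trans hm₂.symm))]
  exact hle.trans_lt hlt

/-! ### Supporting functionals of noncrossing sets -/

/-- The vertices indexed by a noncrossing set of arcs are linearly independent: the positive and
the negative part of a linear dependence are noncrossing weights with the same marginals. -/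
theorem Noncrossing.linearIndepOn {n : ℕ} {T : Finset (Arc n)}
    (hT : Noncrossing (T : Set (Arc n))) :
    LinearIndepOn ℝ arcPoint (T : Set (Arc n)) := by
  rw [linearIndepOn_finset_iff]
  intro f hf
  let u : Arc n → ℝ := fun a => if a ∈ T then f a else 0
  have hu : marginals u = 0 := by
    rw [← hf, marginals_apply]
    simp [u, ite_smul]
  have huT : ∀ a ∉ T, u a = 0 := fun a ha => if_neg ha
  have key : u⁺ = u⁻ := by
    refine noncrossing_weight_unique (posPart_nonneg u) (negPart_nonneg u)
      (hT.mono fun a ha => ?_) (hT.mono fun a ha => ?_) ?_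
    · by_contra h
      exact ha (by simp [huT a h])
    · by_contra h
      exact ha (by simp [huT a h])
    · rw [← sub_eq_zero, ← map_sub, posPart_sub_negPart, hu]
  have hu0 : u = 0 := by rw [← posPart_sub_negPart u, key, sub_self]
  intro a ha
  have := congrFun hu0 a
  simpa [u, ha] using this

/-- Values on linearly independent vertices extend to a linear functional. -/
theorem Noncrossing.exists_linearMap_eq {n : ℕ} {T : Finset (Arc n)}
    (hT : Noncrossing (T : Set (Arc n))) (h : Arc n → ℝ) :
    ∃ φ : ProdSpace n →ₗ[ℝ] ℝ, ∀ a ∈ T, φ (arcPoint a) = h a := by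
  have hli : LinearIndependent ℝ fun a : (T : Set (Arc n)) => arcPoint (a : Arc n) :=
    hT.linearIndepOn
  obtain ⟨g, hg⟩ := LinearMap.exists_leftInverse_of_injective _
    (LinearMap.ker_eq_bot.2 hli)
  refine ⟨(Finsupp.linearCombination ℝ fun a : (T : Set (Arc n)) => h a) ∘ₗ g, fun a ha => ?_⟩
  have := LinearMap.congr_fun hg (Finsupp.single (⟨a, ha⟩ : (T : Set (Arc n))) 1)
  simp only [LinearMap.comp_apply, Finsupp.linearCombination_single, one_smul,
    LinearMap.id_apply] at this
  simp [this]

/-- A maximal noncrossing subset of an uncrossing-closed set spans it. The noncrossing weight with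
the marginals of `1_T + t • 1_a` tends to `1_T` as `t` tends to `0`, so that for small `t` its
support contains `T` and therefore equals `T`. -/
theorem exists_marginals_eq_arcPoint {n : ℕ} {A T : Finset (Arc n)} (hA : UncrossingClosed A)
    (hT : Maximal (fun F : Finset (Arc n) => F ⊆ A ∧ Noncrossing (F : Set (Arc n))) T)
    {a : Arc n} (ha : a ∈ A) :
    ∃ u : Arc n → ℝ, (∀ b ∉ T, u b = 0) ∧ marginals u = arcPoint a := by
  obtain ⟨h, hh⟩ := exists_isNoncrossingHeightOn A
  let e : Arc n → ℝ := fun b => if b ∈ T then 1 else 0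
  have he : 0 ≤ e := fun b => by
    simp only [e]
    split_ifs <;> simp
  have heT : ∀ b ∉ T, e b = 0 := fun b hb => if_neg hb
  let t : ℕ → ℝ := fun k => 1 / ((k : ℝ) + 1)
  have ht0 : ∀ k, 0 < t k := fun k => Nat.one_div_pos_of_nat
  have ht1 : ∀ k, t k ≤ 1 := fun k => by
    simpa [t] using Nat.one_div_le_one_div (α := ℝ) (Nat.zero_le k)
  have hv : ∀ k, 0 ≤ e + Pi.single a (t k) := fun k =>
    add_nonneg he (Pi.single_nonneg.2 (ht0 k).le)
  have hvA : ∀ k, ∀ b ∉ A, (e + Pi.single a (t k) : Arc n → ℝ) b = 0 := by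
    intro k b hb
    have h1 : b ≠ a := fun h => hb (h ▸ ha)
    simp [h1, heT b fun h => hb (hT.prop.1 h)]
  choose w hw hwA hwm hwN _ using fun k => exists_noncrossing_weight hA hh (hv k) (hvA k)
  have hmem : ∀ k, w k ∈ Set.Icc (0 : Arc n → ℝ) fun _ => ∑ b, e b + 1 := by
    refine fun k => ⟨hw k, fun b => ?_⟩
    calc w k b ≤ ∑ b, w k b := Finset.single_le_sum (fun b _ => hw k b) (Finset.mem_univ b)
      _ = ∑ b, e b + t k := by
        rw [sum_eq_of_marginals_eq (hwm k)]
        simp [Finset.sum_add_distrib]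
      _ ≤ ∑ b, e b + 1 := by linarith [ht1 k]
  obtain ⟨v, hvmem, φ, hφ, hlim⟩ := isCompact_Icc.tendsto_subseq hmem
  have hcoord : ∀ b, Filter.Tendsto (fun k => w (φ k) b) Filter.atTop (nhds (v b)) := fun b =>
    (tendsto_pi_nhds.1 hlim) b
  have hvm : marginals v = marginals e := by
    refine tendsto_nhds_unique
      ((marginals.continuous_of_finiteDimensional.tendsto v).comp hlim) ?_
    have h1 : Filter.Tendsto (fun k => marginals e + t (φ k) • arcPoint a) Filter.atTop
        (nhds (marginals e + (0 : ℝ) • arcPoint a)) :=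
      tendsto_const_nhds.add
        ((tendsto_one_div_add_atTop_nhds_zero_nat.comp hφ.tendsto_atTop).smul_const _)
    rw [zero_smul, add_zero] at h1
    refine h1.congr fun k => ?_
    simp [hwm, marginals_single]
  have hpos : ∀ b, 0 < v b → ∀ᶠ k in Filter.atTop, 0 < w (φ k) b := fun b hb =>
    (hcoord b).eventually (lt_mem_nhds hb)
  have hvN : Noncrossing (Function.support v) := by
    intro b hb c hc
    obtain ⟨k, hkb, hkc⟩ := ((hpos b (lt_of_le_of_ne (hvmem.1 b) (Ne.symm hb))).and
      (hpos c (lt_of_le_of_ne (hvmem.1 c) (Ne.symm hc)))).exists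
    exact hwN _ b hkb.ne' c hkc.ne'
  have hve : v = e := by
    refine noncrossing_weight_unique hvmem.1 he hvN (hT.prop.2.mono fun b hb => ?_) hvm
    by_contra h
    exact hb (heT b h)
  obtain ⟨k, hk⟩ : ∃ k, ∀ b ∈ T, 0 < w (φ k) b := by
    refine ((Filter.eventually_all_finset T).2 fun b hb => hpos b ?_).exists
    simp [hve, e, hb]
  have hsupp : ∀ b ∉ T, w (φ k) b = 0 := by
    let F : Finset (Arc n) := Finset.univ.filter fun b => w (φ k) b ≠ 0
    have hF : F ⊆ T := by
      refine hT.le_of_ge ⟨fun b hb => ?_, (hwN (φ k)).mono fun b hb => ?_⟩ fun b hb => ?_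
      · by_contra h
        exact (Finset.mem_filter.1 hb).2 (hwA _ b h)
      · exact (Finset.mem_filter.1 hb).2
      · exact Finset.mem_filter.2 ⟨Finset.mem_univ _, (hk b hb).ne'⟩
    intro b hb
    by_contra h
    exact hb (hF (Finset.mem_filter.2 ⟨Finset.mem_univ _, h⟩))
  refine ⟨(t (φ k))⁻¹ • (w (φ k) - e), fun b hb => by simp [hsupp b hb, heT b hb], ?_⟩
  rw [map_smul, map_sub, hwm, map_add, marginals_single, add_sub_cancel_left, smul_smul,
    inv_mul_cancel₀ (ht0 _).ne', one_smul]

theorem map_marginals {n : ℕ} (φ : ProdSpace n →ₗ[ℝ] ℝ) (u : Arc n → ℝ) :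
    φ (marginals u) = totalHeight (fun a => φ (arcPoint a)) u := by
  simp [marginals_apply, totalHeight_apply]

/-- The functional that interpolates a noncrossing height on a maximal noncrossing set lies
strictly below the height on all other arcs. -/
theorem lt_of_maximal_of_eq {n : ℕ} {A T : Finset (Arc n)} (hA : UncrossingClosed A)
    (hT : Maximal (fun F : Finset (Arc n) => F ⊆ A ∧ Noncrossing (F : Set (Arc n))) T)
    {h : Arc n → ℝ} (hh : IsNoncrossingHeightOn A h) {φ : ProdSpace n →ₗ[ℝ] ℝ}
    (hφ : ∀ a ∈ T, φ (arcPoint a) = h a) {a : Arc n} (ha : a ∈ A) (haT : a ∉ T) :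
    φ (arcPoint a) < h a := by
  obtain ⟨u, huT, hu⟩ := exists_marginals_eq_arcPoint hA hT ha
  -- Moving the negative coefficients of `u` to the other side gives two nonnegative weights with
  -- the same marginals, of which `u⁺` is noncrossing.
  have hlt : totalHeight h u⁺ < totalHeight h (Pi.single a 1 + u⁻) := by
    refine totalHeight_lt_of_noncrossing hA hh (posPart_nonneg u) (hT.prop.2.mono fun b hb => ?_)
      (add_nonneg (Pi.single_nonneg.2 zero_le_one) (negPart_nonneg u)) (fun b hb => ?_) ?_
      fun he => ?_
    · by_contra h
      exact hb (by simp [huT b h])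
    · have h1 : b ≠ a := fun h => hb (h ▸ ha)
      simp [h1, huT b fun h => hb (hT.prop.1 h)]
    · rw [map_add, marginals_single, one_smul, ← hu, ← sub_eq_iff_eq_add, ← map_sub,
        posPart_sub_negPart]
    · have := congrFun he a
      simp [huT a haT] at this
  have hφu : φ (arcPoint a) = totalHeight h u := by
    rw [← hu, map_marginals, totalHeight_apply, totalHeight_apply]
    refine Finset.sum_congr rfl fun b _ => ?_
    by_cases hb : b ∈ T
    · rw [hφ b hb]
    · simp [huT b hb]
  rw [map_add, totalHeight_single, one_mul, ← sub_lt_iff_lt_add, ← map_sub,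
    posPart_sub_negPart] at hlt
  rwa [hφu]

/-- Every noncrossing set is the contact set of a functional below the height: tilt the functional
of a maximal noncrossing superset slightly. -/
theorem exists_supporting_linearMap {n : ℕ} {A F : Finset (Arc n)} (hA : UncrossingClosed A)
    (hFA : F ⊆ A) (hF : Noncrossing (F : Set (Arc n)))
    {h : Arc n → ℝ} (hh : IsNoncrossingHeightOn A h) :
    ∃ φ : ProdSpace n →ₗ[ℝ] ℝ, (∀ a ∈ F, φ (arcPoint a) = h a) ∧
      ∀ a ∈ A, a ∉ F → φ (arcPoint a) < h a := by
  obtain ⟨T, hFT, hT⟩ := Finite.exists_le_maximal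
    (p := fun F : Finset (Arc n) => F ⊆ A ∧ Noncrossing (F : Set (Arc n))) ⟨hFA, hF⟩
  obtain ⟨φ, hφ⟩ := hT.prop.2.exists_linearMap_eq h
  obtain ⟨ψ, hψ⟩ := hT.prop.2.exists_linearMap_eq fun a => if a ∈ F then 0 else 1
  have hev : ∀ᶠ ε : ℝ in nhdsWithin 0 (Set.Ioi 0), ∀ a ∈ A, a ∉ T →
      φ (arcPoint a) - ε * ψ (arcPoint a) < h a := by
    refine (Filter.eventually_all_finset A).2 fun a ha => ?_
    by_cases haT : a ∈ T
    · simp [haT]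
    · have hc : Continuous fun ε : ℝ => φ (arcPoint a) - ε * ψ (arcPoint a) := by fun_prop
      have := (hc.tendsto 0).eventually_lt_const (u := h a)
        (by simpa using lt_of_maximal_of_eq hA hT hh hφ ha haT)
      filter_upwards [nhdsWithin_le_nhds this] with ε hε _ using hε
  obtain ⟨ε, hε, hε0⟩ := (hev.and self_mem_nhdsWithin).exists
  have hε0 : 0 < ε := hε0
  refine ⟨φ - ε • ψ, fun a ha => ?_, fun a ha haF => ?_⟩
  · simp [hφ a (hFT ha), hψ a (hFT ha), ha]
  · by_cases haT : a ∈ T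
    · simp [hφ a haT, hψ a haT, haF, hε0]
    · simpa using hε a ha haT

/-! ### The complex of noncrossing sets -/

theorem mem_convexHull_image_iff {n : ℕ} {E : Type*} [AddCommGroup E] [Module ℝ E]
    (g : Arc n → E) (F : Finset (Arc n)) (x : E) :
    x ∈ convexHull ℝ (g '' (F : Set (Arc n))) ↔
      ∃ w : Arc n → ℝ, 0 ≤ w ∧ (∀ a ∉ F, w a = 0) ∧ ∑ a, w a = 1 ∧ ∑ a, w a • g a = x := by
  constructor
  · intro hx
    refine convexHull_min (t := {x | ∃ w : Arc n → ℝ, 0 ≤ w ∧ (∀ a ∉ F, w a = 0) ∧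
      ∑ a, w a = 1 ∧ ∑ a, w a • g a = x}) ?_ ?_ hx
    · rintro _ ⟨a, ha, rfl⟩
      refine ⟨Pi.single a 1, Pi.single_nonneg.2 zero_le_one, fun b hb =>
        Pi.single_eq_of_ne (ne_of_mem_of_not_mem ha hb).symm _, by simp, ?_⟩
      simp [Pi.single_apply, ite_smul]
    · rintro _ ⟨w, hw, hwF, hw1, rfl⟩ _ ⟨v, hv, hvF, hv1, rfl⟩ s t hs ht hst
      refine ⟨s • w + t • v, add_nonneg (smul_nonneg hs hw) (smul_nonneg ht hv),
        fun a ha => by simp [hwF a ha, hvF a ha], ?_, ?_⟩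
      · simp [Finset.sum_add_distrib, ← Finset.mul_sum, hw1, hv1, hst]
      · simp [add_smul, Finset.sum_add_distrib, Finset.smul_sum, mul_smul]
  · rintro ⟨w, hw, hwF, hw1, rfl⟩
    rw [← Finset.sum_subset (Finset.subset_univ F) fun a _ ha => by rw [hwF a ha, zero_smul]]
    rw [← Finset.sum_subset (Finset.subset_univ F) fun a _ ha => hwF a ha] at hw1
    exact (convex_convexHull ℝ _).sum_mem (fun a _ => hw a) hw1
      fun a ha => subset_convexHull ℝ _ ⟨a, ha, rfl⟩

theorem mem_arcPolytope_iff {n : ℕ} {F : Finset (Arc n)} {x : ProdSpace n} :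
    x ∈ arcPolytope F ↔
      ∃ w : Arc n → ℝ, 0 ≤ w ∧ (∀ a ∉ F, w a = 0) ∧ ∑ a, w a = 1 ∧ marginals w = x :=
  mem_convexHull_image_iff arcPoint F x

theorem arcPoint_mem_arcPolytope {n : ℕ} {F : Finset (Arc n)} {a : Arc n} (ha : a ∈ F) :
    arcPoint a ∈ arcPolytope F :=
  subset_convexHull ℝ _ ⟨a, ha, rfl⟩

theorem arcPolytope_mono {n : ℕ} {F G : Finset (Arc n)} (h : F ⊆ G) :
    arcPolytope F ⊆ arcPolytope G :=
  convexHull_mono (Set.image_mono (Finset.coe_subset.2 h))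

theorem arcPolytope_nonempty_iff {n : ℕ} {F : Finset (Arc n)} :
    (arcPolytope F).Nonempty ↔ F.Nonempty := by
  simp [arcPolytope]

theorem coe_arcSimplex {n : ℕ} (F : Finset (Arc n)) :
    (arcSimplex F : Set (ProdSpace n)) = arcPoint '' (F : Set (Arc n)) := by
  simp [arcSimplex]

theorem convexHull_arcSimplex {n : ℕ} (F : Finset (Arc n)) :
    convexHull ℝ (arcSimplex F : Set (ProdSpace n)) = arcPolytope F := by
  rw [coe_arcSimplex, arcPolytope]

theorem arcSimplex_subset_arcSimplex {n : ℕ} {F G : Finset (Arc n)} :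
    arcSimplex F ⊆ arcSimplex G ↔ F ⊆ G :=
  Finset.map_subset_map

theorem arcSimplex_injective {n : ℕ} : Function.Injective (arcSimplex (n := n)) :=
  Finset.map_injective _

theorem noncrossing_support {n : ℕ} {F : Finset (Arc n)} (hF : Noncrossing (F : Set (Arc n)))
    {w : Arc n → ℝ} (hw : ∀ a ∉ F, w a = 0) : Noncrossing (Function.support w) :=
  hF.mono fun a ha => by_contra fun h => ha (hw a h)

theorem arcPolytope_inter_subset {n : ℕ} {F G : Finset (Arc n)}
    (hF : Noncrossing (F : Set (Arc n))) (hG : Noncrossing (G : Set (Arc n))) :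
    arcPolytope F ∩ arcPolytope G ⊆ arcPolytope (F ∩ G) := by
  rintro x ⟨hx, hx'⟩
  obtain ⟨w, hw, hwF, hw1, rfl⟩ := mem_arcPolytope_iff.1 hx
  obtain ⟨v, hv, hvG, -, hm⟩ := mem_arcPolytope_iff.1 hx'
  have hwv := noncrossing_weight_unique hw hv (noncrossing_support hF hwF)
    (noncrossing_support hG hvG) hm.symm
  refine mem_arcPolytope_iff.2 ⟨w, hw, fun a ha => ?_, hw1, rfl⟩
  by_cases haF : a ∈ F
  · rw [hwv]
    exact hvG a fun h => ha (Finset.mem_inter.2 ⟨haF, h⟩)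
  · exact hwF a haF

theorem noncrossing_singleton {n : ℕ} (a : Arc n) :
    Noncrossing (({a} : Finset (Arc n)) : Set (Arc n)) := by
  simpa using noncrossing_pair (a := a) (b := a) fun h => h.fst_ne rfl

theorem mem_of_arcPoint_mem_arcPolytope {n : ℕ} {F : Finset (Arc n)}
    (hF : Noncrossing (F : Set (Arc n))) {a : Arc n} (h : arcPoint a ∈ arcPolytope F) :
    a ∈ F := by
  have := arcPolytope_inter_subset hF (noncrossing_singleton a)
    ⟨h, arcPoint_mem_arcPolytope (Finset.mem_singleton_self a)⟩
  obtain ⟨b, hb⟩ := arcPolytope_nonempty_iff.1 ⟨_, this⟩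
  obtain ⟨hbF, hba⟩ := Finset.mem_inter.1 hb
  rwa [← Finset.mem_singleton.1 hba]

/-- A noncrossing set of arcs is recovered from its simplex, even among arbitrary sets of arcs. -/
theorem eq_of_arcPolytope_eq {n : ℕ} {F G : Finset (Arc n)}
    (hF : Noncrossing (F : Set (Arc n))) (h : arcPolytope G = arcPolytope F) : G = F := by
  have hGF : G ⊆ F := fun a ha =>
    mem_of_arcPoint_mem_arcPolytope hF (h ▸ arcPoint_mem_arcPolytope ha)
  refine hGF.antisymm fun a ha => ?_
  exact mem_of_arcPoint_mem_arcPolytope (hF.mono (Finset.coe_subset.2 hGF))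
    (h ▸ arcPoint_mem_arcPolytope ha)

/-- The simplicial complex whose faces are the simplices of the nonempty noncrossing subsets of
`A`. -/
def noncrossingComplex {n : ℕ} (A : Finset (Arc n)) :
    Geometry.SimplicialComplex ℝ (ProdSpace n) where
  faces := {s | ∃ F : Finset (Arc n), F.Nonempty ∧ F ⊆ A ∧ Noncrossing (F : Set (Arc n)) ∧
    arcSimplex F = s}
  isRelLowerSet_faces := by
    rintro _ ⟨F, hF, hFA, hFN, rfl⟩
    refine ⟨by simpa [arcSimplex] using hF, fun t ht htn => ?_⟩
    obtain ⟨G, hGF, rfl⟩ := Finset.subset_map_iff.1 ht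
    exact ⟨G, by simpa using htn, hGF.trans hFA, hFN.mono (Finset.coe_subset.2 hGF), rfl⟩
  indep := by
    rintro _ ⟨F, -, -, hFN, rfl⟩
    have h : LinearIndepOn ℝ id (arcSimplex F : Set (ProdSpace n)) := by
      rw [coe_arcSimplex]
      exact hFN.linearIndepOn.id_image
    exact LinearIndependent.affineIndependent ℝ h
  inter_subset_convexHull := by
    rintro _ _ ⟨F, -, -, hFN, rfl⟩ ⟨G, -, -, hGN, rfl⟩
    have := arcPolytope_inter_subset hFN hGN
    rwa [convexHull_arcSimplex, convexHull_arcSimplex, coe_arcSimplex, coe_arcSimplex,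
      ← Set.image_inter arcPoint_injective, ← Finset.coe_inter]

theorem mem_complexCells_noncrossingComplex {n : ℕ} {A : Finset (Arc n)} {C : Set (ProdSpace n)} :
    C ∈ complexCells (noncrossingComplex A) ↔ ∃ F : Finset (Arc n), F.Nonempty ∧ F ⊆ A ∧
      Noncrossing (F : Set (Arc n)) ∧ C = arcPolytope F := by
  constructor
  · rintro ⟨_, ⟨F, hF, hFA, hFN, rfl⟩, rfl⟩
    exact ⟨F, hF, hFA, hFN, convexHull_arcSimplex F⟩
  · rintro ⟨F, hF, hFA, hFN, rfl⟩
    exact ⟨_, ⟨F, hF, hFA, hFN, rfl⟩, (convexHull_arcSimplex F).symm⟩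

theorem noncrossingComplex_space {n : ℕ} {A : Finset (Arc n)} (hA : UncrossingClosed A) :
    (noncrossingComplex A).space = arcPolytope A := by
  ext x
  rw [Geometry.SimplicialComplex.mem_space_iff]
  constructor
  · rintro ⟨_, ⟨F, -, hFA, -, rfl⟩, hx⟩
    rw [convexHull_arcSimplex] at hx
    exact arcPolytope_mono hFA hx
  · intro hx
    obtain ⟨h, hh⟩ := exists_isNoncrossingHeightOn A
    obtain ⟨v, hv, hvA, hv1, rfl⟩ := mem_arcPolytope_iff.1 hx
    obtain ⟨w, hw, hwA, hwv, hwN, -⟩ := exists_noncrossing_weight hA hh hv hvA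
    have hmem : marginals v ∈ arcPolytope (Finset.univ.filter fun a => w a ≠ 0) :=
      mem_arcPolytope_iff.2 ⟨w, hw, fun a ha => by simpa using ha,
        (sum_eq_of_marginals_eq hwv).trans hv1, hwv⟩
    refine ⟨_, ⟨_, arcPolytope_nonempty_iff.1 ⟨_, hmem⟩, fun a ha => ?_, ?_, rfl⟩,
      (convexHull_arcSimplex _).symm ▸ hmem⟩
    · by_contra h
      exact (Finset.mem_filter.1 ha).2 (hwA a h)
    · exact hwN.mono fun a ha => (Finset.mem_filter.1 ha).2

theorem noncrossingComplex_isFlagComplex {n : ℕ} (A : Finset (Arc n)) :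
    IsFlagComplex (noncrossingComplex A) := by
  intro s hs hpair
  let F : Finset (Arc n) := Finset.univ.filter fun a => arcPoint a ∈ s
  have hF : ∀ {a}, a ∈ F ↔ arcPoint a ∈ s := by simp [F]
  have hFs : arcSimplex F = s := by
    ext x
    constructor
    · intro hx
      obtain ⟨a, ha, rfl⟩ := Finset.mem_map.1 hx
      exact hF.1 ha
    · intro hx
      obtain ⟨_, ⟨G, -, -, -, rfl⟩, hxG, -⟩ := hpair x hx x hx
      obtain ⟨a, -, rfl⟩ := Finset.mem_map.1 hxG
      exact Finset.mem_map.2 ⟨a, hF.2 hx, rfl⟩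
  have key : ∀ a ∈ F, ∀ b ∈ F, a ∈ A ∧ ¬ CyclicallyCross a b := by
    intro a ha b hb
    obtain ⟨_, ⟨G, -, hGA, hGN, rfl⟩, haG, hbG⟩ := hpair _ (hF.1 ha) _ (hF.1 hb)
    have haG : a ∈ G := (Finset.mem_map' _).1 haG
    have hbG : b ∈ G := (Finset.mem_map' _).1 hbG
    exact ⟨hGA haG, hGN a haG b hbG⟩
  refine ⟨F, ?_, fun a ha => (key a ha a ha).1, fun a ha b hb => (key a ha b hb).2, hFs⟩
  rw [← hFs] at hs
  simpa [arcSimplex] using hs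

theorem bijOn_facets_noncrossingComplex {n : ℕ} {A : Finset (Arc n)} (hA : A.Nonempty) :
    Set.BijOn arcSimplex
      {T | Maximal (fun F : Finset (Arc n) => F ⊆ A ∧ Noncrossing (F : Set (Arc n))) T}
      (noncrossingComplex A).facets := by
  refine ⟨fun T hT => ?_, arcSimplex_injective.injOn, ?_⟩
  · rw [Set.mem_ofPred_eq] at hT
    refine ⟨⟨T, ?_, hT.prop.1, hT.prop.2, rfl⟩, ?_⟩
    · rw [Finset.nonempty_iff_ne_empty]
      rintro rfl
      obtain ⟨a, ha⟩ := hA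
      have := hT.le_of_ge (y := {a})
        ⟨Finset.singleton_subset_iff.2 ha, noncrossing_singleton a⟩ (Finset.empty_subset _)
      exact absurd (this (Finset.mem_singleton_self a)) (Finset.notMem_empty a)
    · rintro _ ⟨G, -, hGA, hGN, rfl⟩ hTG
      exact congrArg _ (hT.eq_of_le ⟨hGA, hGN⟩ (arcSimplex_subset_arcSimplex.1 hTG))
  · rintro _ ⟨⟨F, hF, hFA, hFN, rfl⟩, hmax⟩
    refine ⟨F, ⟨⟨hFA, hFN⟩, fun G hG hFG => ?_⟩, rfl⟩
    have := hmax ⟨G, hF.mono hFG, hG.1, hG.2, rfl⟩ (arcSimplex_subset_arcSimplex.2 hFG)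
    exact (arcSimplex_injective this).ge

/-! ### The regular subdivision of a noncrossing height -/

theorem forall_liftedPolytope_iff {n : ℕ} {A : Finset (Arc n)} {h : Arc n → ℝ}
    {φ : ProdSpace n →ₗ[ℝ] ℝ} {c : ℝ} :
    (∀ z ∈ liftedPolytope A h, φ z.1 + c ≤ z.2) ↔ ∀ a ∈ A, φ (arcPoint a) + c ≤ h a := by
  constructor
  · intro H a ha
    exact H _ (subset_convexHull ℝ _ ⟨a, ha, rfl⟩)
  · intro H z hz
    have hconv : Convex ℝ {z : ProdSpace n × ℝ | φ z.1 + c ≤ z.2} := by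
      intro x hx y hy s t hs ht hst
      simp only [Set.mem_ofPred_eq, Prod.fst_add, Prod.snd_add, Prod.smul_fst, Prod.smul_snd,
        map_add, map_smul, smul_eq_mul] at *
      have h1 := mul_le_mul_of_nonneg_left hx hs
      have h2 := mul_le_mul_of_nonneg_left hy ht
      have h3 : c = s * c + t * c := by rw [← add_mul, hst, one_mul]
      linarith
    refine convexHull_min ?_ hconv hz
    rintro _ ⟨a, ha, rfl⟩
    exact H a ha

/-- The projected face of the lifted polytope cut out by a supporting function `φ + c` is
spanned by the arcs at which `φ + c` agrees with the height. -/
theorem fst_image_lowerFace {n : ℕ} {A : Finset (Arc n)} {h : Arc n → ℝ}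
    {φ : ProdSpace n →ₗ[ℝ] ℝ} {c : ℝ} (H : ∀ a ∈ A, φ (arcPoint a) + c ≤ h a) :
    Prod.fst '' {z | z ∈ liftedPolytope A h ∧ z.2 = φ z.1 + c} =
      arcPolytope (A.filter fun a => φ (arcPoint a) + c = h a) := by
  ext x
  constructor
  · rintro ⟨z, ⟨hz, hzc⟩, rfl⟩
    obtain ⟨w, hw, hwA, hw1, rfl⟩ := (mem_convexHull_image_iff _ A z).1 hz
    have hz1 : (∑ a, w a • (arcPoint a, h a)).1 = marginals w := by
      simp [marginals_apply, Prod.fst_sum]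
    have hz2 : (∑ a, w a • (arcPoint a, h a)).2 = ∑ a, w a * h a := by
      simp [Prod.snd_sum]
    rw [hz1, hz2, map_marginals, totalHeight_apply] at hzc
    have hsum : ∑ a, w a * (φ (arcPoint a) + c) = ∑ a, w a * h a := by
      rw [hzc]
      simp only [mul_add, Finset.sum_add_distrib, ← Finset.sum_mul, hw1, one_mul]
    have hle : ∀ a ∈ Finset.univ, w a * (φ (arcPoint a) + c) ≤ w a * h a := by
      intro a _
      by_cases ha : a ∈ A
      · exact mul_le_mul_of_nonneg_left (H a ha) (hw a)
      · simp [hwA a ha]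
    have heq := (Finset.sum_eq_sum_iff_of_le hle).1 hsum
    refine mem_arcPolytope_iff.2 ⟨w, hw, fun a ha => ?_, hw1, hz1.symm⟩
    by_cases haA : a ∈ A
    · by_contra h0
      exact ha (Finset.mem_filter.2 ⟨haA, mul_left_cancel₀ h0 (heq a (Finset.mem_univ a))⟩)
    · exact hwA a haA
  · intro hx
    obtain ⟨w, hw, hwA, hw1, rfl⟩ := mem_arcPolytope_iff.1 hx
    refine ⟨∑ a, w a • (arcPoint a, h a), ⟨(mem_convexHull_image_iff _ A _).2
      ⟨w, hw, fun a ha => hwA a fun h' => ha (Finset.mem_filter.1 h').1, hw1, rfl⟩, ?_⟩, ?_⟩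
    · have hz1 : (∑ a, w a • (arcPoint a, h a)).1 = marginals w := by
        simp [marginals_apply, Prod.fst_sum]
      have hz2 : (∑ a, w a • (arcPoint a, h a)).2 = ∑ a, w a * h a := by
        simp [Prod.snd_sum]
      rw [hz1, hz2, map_marginals, totalHeight_apply]
      have : ∀ a, w a * h a = w a * φ (arcPoint a) + w a * c := by
        intro a
        by_cases ha : a ∈ A.filter fun a => φ (arcPoint a) + c = h a
        · rw [← (Finset.mem_filter.1 ha).2, mul_add]
        · simp [hwA a ha]
      simp only [this, Finset.sum_add_distrib, ← Finset.sum_mul, hw1, one_mul]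
    · simp [marginals_apply, Prod.fst_sum]

theorem mem_regularSubdivision_iff {n : ℕ} {A : Finset (Arc n)} {h : Arc n → ℝ}
    {C : Set (ProdSpace n)} :
    C ∈ regularSubdivision A h ↔ ∃ F : Finset (Arc n), F.Nonempty ∧ C = arcPolytope F ∧
      ∃ (φ : ProdSpace n →ₗ[ℝ] ℝ) (c : ℝ), (∀ a ∈ A, φ (arcPoint a) + c ≤ h a) ∧
        F = A.filter fun a => φ (arcPoint a) + c = h a := by
  constructor
  · rintro ⟨hC, φ, c, H, rfl⟩
    rw [forall_liftedPolytope_iff] at H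
    rw [fst_image_lowerFace H] at hC ⊢
    exact ⟨_, arcPolytope_nonempty_iff.1 hC, rfl, φ, c, H, rfl⟩
  · rintro ⟨F, hF, rfl, φ, c, H, rfl⟩
    exact ⟨arcPolytope_nonempty_iff.2 hF, φ, c, forall_liftedPolytope_iff.2 H,
      (fst_image_lowerFace H).symm⟩

theorem inducedByHeights_noncrossingComplex {n : ℕ} {A : Finset (Arc n)}
    (hA : UncrossingClosed A) {h : Arc n → ℝ} (hh : IsNoncrossingHeightOn A h) :
    InducedByHeights (noncrossingComplex A) A h := by
  ext C
  rw [mem_complexCells_noncrossingComplex, mem_regularSubdivision_iff]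
  constructor
  · rintro ⟨F, hF, hFA, hFN, rfl⟩
    obtain ⟨φ, h1, h2⟩ := exists_supporting_linearMap hA hFA hFN hh
    refine ⟨F, hF, rfl, φ, 0, fun a ha => ?_, ?_⟩
    · rw [add_zero]
      by_cases haF : a ∈ F
      · exact (h1 a haF).le
      · exact (h2 a ha haF).le
    · ext a
      simp only [Finset.mem_filter, add_zero]
      exact ⟨fun ha => ⟨hFA ha, h1 a ha⟩,
        fun ⟨ha, he⟩ => by_contra fun haF => (h2 a ha haF).ne he⟩
  · rintro ⟨_, hF, rfl, φ, c, H, rfl⟩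
    refine ⟨_, hF, Finset.filter_subset _ _, fun a ha b hb hc => ?_, rfl⟩
    -- Reconnecting two crossing contact arcs would push the height below `φ + c`.
    obtain ⟨haA, hae⟩ := Finset.mem_filter.1 ha
    obtain ⟨hbA, hbe⟩ := Finset.mem_filter.1 hb
    obtain ⟨hA₁, hA₂⟩ := hA a haA b hbA hc
    have h1 := hh a haA b hbA hc
    have h2 := H _ hA₁
    have h3 := H _ hA₂
    have h4 := congrArg φ (arcPoint_reconnect a b)
    rw [map_add, map_add] at h4
    linarith

/-- Conversely, only noncrossing heights induce the complex: each noncrossing pair of arcs is an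
edge, and its supporting function lies strictly below the height at the reconnected arcs. -/
theorem isNoncrossingHeight_of_inducedByHeights {n : ℕ} {I J : Finset (Fin (n + 1))}
    {h : Arc n → ℝ} (H : InducedByHeights (noncrossingComplex (I ×ˢ J)) (I ×ˢ J) h) :
    IsCyclicallyNoncrossingHeight I J h := by
  intro i hi i' hi' j hj j' hj' hii hjj hnc
  have hpair : Noncrossing (({(i, j), (i', j')} : Finset (Arc n)) : Set (Arc n)) := by
    simpa using noncrossing_pair hnc
  have hcell : arcPolytope {(i, j), (i', j')} ∈ complexCells (noncrossingComplex (I ×ˢ J)) :=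
    mem_complexCells_noncrossingComplex.2 ⟨_, by simp, by
      simp [Finset.insert_subset_iff, hi, hi', hj, hj'], hpair, rfl⟩
  rw [show complexCells _ = _ from H, mem_regularSubdivision_iff] at hcell
  obtain ⟨F, -, hF, φ, c, hle, hFe⟩ := hcell
  have hFp : F = {(i, j), (i', j')} := eq_of_arcPolytope_eq hpair hF.symm
  have mem : ∀ a ∈ I ×ˢ J, a ∈ ({(i, j), (i', j')} : Finset (Arc n)) ↔
      φ (arcPoint a) + c = h a := by
    intro a ha
    rw [← hFp, hFe, Finset.mem_filter, and_iff_right ha]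
  have h1 := (mem (i, j) (by simp [*])).1 (by simp)
  have h2 := (mem (i', j') (by simp [*])).1 (by simp)
  have h3 := lt_of_le_of_ne (hle (i', j) (by simp [*]))
    fun he => by simpa [hii.symm, hjj] using (mem (i', j) (by simp [*])).2 he
  have h4 := lt_of_le_of_ne (hle (i, j') (by simp [*]))
    fun he => by simpa [hii, hjj.symm] using (mem (i, j') (by simp [*])).2 he
  have h5 := congrArg φ (arcPoint_reconnect (i, j) (i', j'))
  rw [map_add, map_add] at h5
  simp only at h5
  linarith

theorem isFlagRegularTriangulation_noncrossingComplex {n : ℕ} {A : Finset (Arc n)}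
    (hA : UncrossingClosed A) : IsFlagRegularTriangulation (noncrossingComplex A) A where
  vertices_subset := by
    rintro _ ⟨F, -, hFA, -, rfl⟩
    rw [coe_arcSimplex]
    exact Set.image_mono (Finset.coe_subset.2 hFA)
  covers := noncrossingComplex_space hA
  flag := noncrossingComplex_isFlagComplex A
  regular := (exists_isNoncrossingHeightOn A).imp
    fun _ hh => inducedByHeights_noncrossingComplex hA hh

/-! ### Restriction to faces of the product, and increasing arcs -/

/-- A point of `Δ_I × Δ_J` has zero marginals outside `I` and `J`, so a weight that represents it
is supported on `I ×ˢ J`. -/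
theorem arcPolytope_inter_product {n : ℕ} (F : Finset (Arc n)) (I J : Finset (Fin (n + 1))) :
    arcPolytope F ∩ arcPolytope (I ×ˢ J) = arcPolytope (F ∩ I ×ˢ J) := by
  refine Set.Subset.antisymm ?_ (Set.subset_inter (arcPolytope_mono Finset.inter_subset_left)
    (arcPolytope_mono Finset.inter_subset_right))
  rintro x ⟨hx, hx'⟩
  obtain ⟨w, hw, hwF, hw1, rfl⟩ := mem_arcPolytope_iff.1 hx
  obtain ⟨v, hv, hvA, -, hm⟩ := mem_arcPolytope_iff.1 hx'
  refine mem_arcPolytope_iff.2 ⟨w, hw, fun a ha => ?_, hw1, rfl⟩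
  by_contra h0
  refine ha (Finset.mem_inter.2 ⟨by_contra fun h => h0 (hwF a h), ?_⟩)
  obtain ⟨⟨j, hj⟩, i, hi⟩ := exists_pos_of_marginals_eq (i := a.1) (j := a.2) hw hm.symm
    (lt_of_le_of_ne (hw a) (Ne.symm h0))
  have h1 : (a.1, j) ∈ I ×ˢ J := by_contra fun h => hj.ne' (hvA _ h)
  have h2 : (i, a.2) ∈ I ×ˢ J := by_contra fun h => hi.ne' (hvA _ h)
  exact Finset.mem_product.2 ⟨(Finset.mem_product.1 h1).1, (Finset.mem_product.1 h2).2⟩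

theorem complexCells_noncrossingComplex_product {n : ℕ} (I J : Finset (Fin (n + 1))) :
    complexCells (noncrossingComplex (I ×ˢ J)) = {C | C.Nonempty ∧
      ∃ D ∈ complexCells (noncrossingComplex (Finset.univ ×ˢ Finset.univ)),
        C = D ∩ arcPolytope (I ×ˢ J)} := by
  ext C
  simp only [mem_complexCells_noncrossingComplex, Set.mem_ofPred_eq]
  constructor
  · rintro ⟨F, hF, hFA, hFN, rfl⟩
    refine ⟨arcPolytope_nonempty_iff.2 hF, _, ⟨F, hF, by simp, hFN, rfl⟩, ?_⟩
    rw [arcPolytope_inter_product, Finset.inter_eq_left.2 hFA]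
  · rintro ⟨hC, _, ⟨F, -, -, hFN, rfl⟩, rfl⟩
    rw [arcPolytope_inter_product] at hC ⊢
    exact ⟨_, arcPolytope_nonempty_iff.1 hC, Finset.inter_subset_right,
      hFN.mono (Finset.coe_subset.2 Finset.inter_subset_left), rfl⟩

/-- Two increasing arcs cyclically cross if and only if they cross in the linear sense: reconnecting
disjoint arcs produces two arcs longer than both of them, and reconnecting nested arcs produces two
arcs longer than the inner one. -/
theorem cyclicallyCross_iff_of_increasing {n : ℕ} {a b : Arc n} (ha : a.1 ≤ a.2) (hb : b.1 ≤ b.2) :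
    CyclicallyCross a b ↔
      (a.1 < b.1 ∧ b.1 ≤ a.2 ∧ a.2 < b.2) ∨ (b.1 < a.1 ∧ a.1 ≤ b.2 ∧ b.2 < a.2) := by
  obtain ⟨i, j⟩ := a
  obtain ⟨i', j'⟩ := b
  have h1 := i.2
  have h2 := i'.2
  have h3 := j.2
  have h4 := j'.2
  simp only [Fin.le_def, Fin.lt_def] at *
  simp only [CyclicallyCross, cyclicLength_eq, ha, hb, if_true]
  split_ifs <;> omega

theorem uncrossingClosed_increasingArcs (n : ℕ) : UncrossingClosed (increasingArcs n) := by
  intro a ha b hb hc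
  simp only [increasingArcs, Finset.mem_filter, Finset.mem_univ, true_and] at *
  rcases (cyclicallyCross_iff_of_increasing ha hb).1 hc with h | h
  · exact ⟨h.2.1, ha.trans h.2.2.le⟩
  · exact ⟨hb.trans h.2.2.le, h.2.1⟩

theorem isIncreasingForest_iff {n : ℕ} (F : Finset (Arc n)) :
    IsIncreasingForest F ↔ F ⊆ increasingArcs n ∧ Noncrossing (F : Set (Arc n)) := by
  refine and_congr_right fun hF => ?_
  have hle : ∀ a ∈ F, a.1 ≤ a.2 := fun a ha => (Finset.mem_filter.1 (hF ha)).2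
  constructor
  · intro H a ha b hb hc
    rcases (cyclicallyCross_iff_of_increasing (hle a ha) (hle b hb)).1 hc with h | h
    · exact H a ha b hb h
    · exact H b hb a ha h
  · intro H a ha b hb h
    exact H a ha b hb ((cyclicallyCross_iff_of_increasing (hle a ha) (hle b hb)).2 (Or.inl h))

theorem mainTheorem3 (n : ℕ) :
    (∃ K : Finset (Fin (n + 1)) → Finset (Fin (n + 1)) →
        Geometry.SimplicialComplex ℝ (ProdSpace n),
      ∀ I J : Finset (Fin (n + 1)), I.Nonempty → J.Nonempty →
        IsFlagRegularTriangulation (K I J) (I ×ˢ J) ∧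
        Set.BijOn arcSimplex {T | IsCyclicTree I J T} (K I J).facets ∧
        complexCells (K I J) = {C | C.Nonempty ∧
          ∃ D ∈ complexCells (K Finset.univ Finset.univ), C = D ∩ arcPolytope (I ×ˢ J)} ∧
        (∀ h : Arc n → ℝ,
          InducedByHeights (K I J) (I ×ˢ J) h ↔ IsCyclicallyNoncrossingHeight I J h) ∧
        (∀ f : ℝ → ℝ, StrictMonoOn f (Set.Icc 0 (n : ℝ)) →
          StrictConcaveOn ℝ (Set.Icc 0 (n : ℝ)) f →
          InducedByHeights (K I J) (I ×ˢ J) (fun a => f (cyclicLength a)))) ∧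
    (∃ L : Geometry.SimplicialComplex ℝ (ProdSpace n),
      IsFlagRegularTriangulation L (increasingArcs n) ∧
      Set.BijOn arcSimplex {T | IsIncreasingTree T} L.facets) := by
  refine ⟨⟨fun I J => noncrossingComplex (I ×ˢ J), fun I J hI hJ => ⟨?_, ?_, ?_, ?_, ?_⟩⟩,
    noncrossingComplex (increasingArcs n), ?_, ?_⟩
  · exact isFlagRegularTriangulation_noncrossingComplex (uncrossingClosed_product I J)
  · exact bijOn_facets_noncrossingComplex (hI.product hJ)
  · exact complexCells_noncrossingComplex_product I J
  · exact fun h => ⟨isNoncrossingHeight_of_inducedByHeights, fun hh =>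
      inducedByHeights_noncrossingComplex (uncrossingClosed_product I J)
        (isNoncrossingHeightOn_product_iff.2 hh)⟩
  · exact fun f hf hc => inducedByHeights_noncrossingComplex (uncrossingClosed_product I J)
      (isNoncrossingHeightOn_comp_cyclicLength hf hc _)
  · exact isFlagRegularTriangulation_noncrossingComplex (uncrossingClosed_increasingArcs n)
  · have h0 : (0, 0) ∈ increasingArcs n := by simp [increasingArcs]
    simpa only [IsIncreasingTree, funext fun F => propext (isIncreasingForest_iff F)]
      using bijOn_facets_noncrossingComplex ⟨_, h0⟩
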